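/- Let $n \in \mathbb{N}$ and let $M_n = M_n(\mathbb{C})$ be the algebra of complex $n \times n$ matrices. Let $\rho$ be a quasi-order (a reflexive and transitive relation) on $\{1,\ldots,n\}$, and let $$\mathcal{A}_\rho = \{A \in M_n : A_{ij} \neq 0 \implies (i,j) \in \rho\}$$ be the structural matrix algebra defined by $\rho$, which is a unital subalgebra of $M_n$. Let $\phi : \mathcal{A}_\rho \to M_n$ be a map. Then $\phi$ is a linear rank preserver (that is, $\phi$ is $\mathbb{C}$-linear and $\operatorname{rank} \phi(X) = \operatorname{rank} X$ for all $X \in \mathcal{A}_\rho$) if and only if there exist invertible matrices $S, T \in M_n$ and an idempotent $P$ in the centre $Z(\mathcal{A}_\rho)$ of $\mathcal{A}_\rho$ such that $$\phi(X) = S\left(PX + (I-P)X^t\right)T \qquad \text{for all } X \in \mathcal{A}_\rho,$$ where $X^t$ denotes the transpose of $X$ and $I$ the identity matrix. -/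

import Mathlib

/-- The structural matrix algebra `A_ρ ⊆ M_n(ℂ)` defined by a quasi-order (reflexive and transitive
relation) `ρ` on the index set: all complex matrices whose support is contained in `ρ`. -/
def structuralMatrixAlgebra {n : ℕ} (ρ : Fin n → Fin n → Prop)
    (hrefl : ∀ i, ρ i i) (htrans : ∀ i j k, ρ i j → ρ j k → ρ i k) :
    Subalgebra ℂ (Matrix (Fin n) (Fin n) ℂ) where
  carrier := {A | ∀ i j, A i j ≠ 0 → ρ i j}
  mul_mem' := by
    intro A B hA hB i j hij
    rw [Matrix.mul_apply] at hij
    obtain ⟨k, -, hk⟩ := Finset.exists_ne_zero_of_sum_ne_zero hij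
    exact htrans i k j (hA i k (left_ne_zero_of_mul hk)) (hB k j (right_ne_zero_of_mul hk))
  add_mem' := by
    intro A B hA hB i j hij
    by_cases h : A i j = 0
    · refine hB i j fun h' => hij ?_
      rw [Matrix.add_apply, h, h', add_zero]
    · exact hA i j h
  algebraMap_mem' := by
    intro c i j hij
    by_cases h : i = j
    · exact h ▸ hrefl i
    · exact absurd (by rw [Matrix.algebraMap_matrix_apply, if_neg h]) hij

/-- A map from a subalgebra of `M_n(ℂ)` to `M_n(ℂ)` is a linear rank preserver if it is
`ℂ`-linear and the rank of each image equals the rank of the matrix itself. -/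
def IsLinearRankPreserver {n : ℕ} {A : Subalgebra ℂ (Matrix (Fin n) (Fin n) ℂ)}
    (φ : A → Matrix (Fin n) (Fin n) ℂ) : Prop :=
  IsLinearMap ℂ φ ∧ ∀ X : A, (φ X).rank = (X : Matrix (Fin n) (Fin n) ℂ).rank

open Matrix

/-! ### Rank splitting and rank-one perturbations. -/

section RankLemmas

variable {n : ℕ}

/-! Each `Φ(E_ii)` has rank one and `Φ(I)` has rank `n`, so multiplying by invertible matrices on
both sides gives `Φ(E_ii) = E_ii`. Vanishing 2×2 minors of images of rank-one matrices then force
`Φ(E_ij)`, `i ≠ j`, to be a nonzero multiple of `E_ij` or of `E_ji` (`map_single_apply_eq_zero`,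
`map_single_apply_ne_zero_iff`). The choice agrees along related indices (`isTwistedAt_iff`), so the
indicator of the untwisted indices is a central idempotent `P`.

Up to this partial transpose, which preserves rank, `Φ` is a Schur multiplier `c`, and `c i j = s i
* t j` on `ρ` is needed (`exists_eq_mul_of_rank_schur`). Positions are edges of a bipartite graph on
rows and columns, added one at a time. An edge joining two components is absorbed by rescaling one
of them. For an edge closing a cycle, a matrix supported on the existing path has a rank that
singles out one value of the new entry, which leaves no freedom for `c` (`exists_matrix_of_isPath`,
`rank_add_single_ne`).

Conversely, a central `P` is diagonal, and rank splits along it. -/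

theorem exists_eq_vecMulVec_of_rank_le_one {M : Matrix (Fin n) (Fin n) ℂ} (h : M.rank ≤ 1) :
    ∃ u v : Fin n → ℂ, M = vecMulVec u v := by
  obtain ⟨v, hv⟩ := finrank_le_one_iff.mp h
  have key : ∀ j, ∃ x : ℂ, ∀ i, M i j = x * (v : Fin n → ℂ) i := by
    intro j
    obtain ⟨x, hx⟩ := hv ⟨M.mulVecLin (Pi.single j 1), LinearMap.mem_range_self _ _⟩
    refine ⟨x, fun i => ?_⟩
    have := congrFun (congrArg Subtype.val hx) i
    simpa using this.symm
  choose x hx using key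
  refine ⟨v, x, ?_⟩
  ext i j
  rw [hx, vecMulVec_apply, mul_comm]

theorem rank_le_one_minor {M : Matrix (Fin n) (Fin n) ℂ} (h : M.rank ≤ 1) (a b c d : Fin n) :
    M a b * M c d = M a d * M c b := by
  obtain ⟨u, v, rfl⟩ := exists_eq_vecMulVec_of_rank_le_one h
  simp only [vecMulVec_apply]
  ring

/-- Since `P` commutes with `M`, the range of `M` is the direct sum of its parts in the ranges of
`P` and `1 - P`. -/
theorem rank_eq_add_of_commute_idempotent {P M : Matrix (Fin n) (Fin n) ℂ}
    (hP : P * P = P) (hc : P * M = M * P) :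
    M.rank = (P * M).rank + ((1 - P) * M).rank := by
  have hc' : (1 - P) * M = M * (1 - P) := by rw [sub_mul, mul_sub, hc, one_mul, mul_one]
  have hQ : P * (1 - P) = 0 := by rw [mul_sub, hP, mul_one, sub_self]
  have hsup : LinearMap.range (P * M).mulVecLin ⊔ LinearMap.range ((1 - P) * M).mulVecLin
      = LinearMap.range M.mulVecLin := by
    apply le_antisymm
    · rw [sup_le_iff]
      constructor
      · rintro _ ⟨x, rfl⟩
        exact ⟨P *ᵥ x, by simp [hc]⟩
      · rintro _ ⟨x, rfl⟩
        exact ⟨(1 - P) *ᵥ x, by simp only [mulVecLin_apply, mulVec_mulVec, hc']⟩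
    · rintro _ ⟨x, rfl⟩
      refine Submodule.mem_sup.mpr ⟨_, ⟨x, rfl⟩, _, ⟨x, rfl⟩, ?_⟩
      simp only [mulVecLin_apply, ← add_mulVec, ← add_mul, add_sub_cancel, one_mul]
  have hinf : LinearMap.range (P * M).mulVecLin ⊓ LinearMap.range ((1 - P) * M).mulVecLin = ⊥ := by
    rw [eq_bot_iff]
    rintro _ ⟨⟨x, rfl⟩, ⟨y, hy⟩⟩
    have h1 : P *ᵥ ((P * M) *ᵥ x) = P *ᵥ (((1 - P) * M) *ᵥ y) := by
      simpa only [mulVecLin_apply] using congrArg (P *ᵥ ·) hy.symm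
    rw [mulVec_mulVec, mulVec_mulVec, ← mul_assoc, ← mul_assoc, hP, hQ, zero_mul,
      zero_mulVec] at h1
    simpa using h1
  have := Submodule.finrank_sup_add_finrank_inf_eq (LinearMap.range (P * M).mulVecLin)
    (LinearMap.range ((1 - P) * M).mulVecLin)
  rw [hsup, hinf, finrank_bot, add_zero] at this
  exact this

/-- Transposing the part of `X` cut off by a symmetric idempotent commuting with `X` preserves
the rank. -/
theorem rank_partialTranspose {P X : Matrix (Fin n) (Fin n) ℂ}
    (hP : P * P = P) (hPt : Pᵀ = P) (hc : P * X = X * P) :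
    (P * X + (1 - P) * Xᵀ).rank = X.rank := by
  have hct : P * Xᵀ = Xᵀ * P := by
    have := congrArg transpose hc
    rw [transpose_mul, transpose_mul, hPt] at this
    exact this.symm
  have hQ : P * (1 - P) = 0 := by rw [mul_sub, hP, mul_one, sub_self]
  have hQ' : (1 - P) * P = 0 := by rw [sub_mul, hP, one_mul, sub_self]
  have hQQ : (1 - P) * (1 - P) = 1 - P := by rw [mul_sub, hQ', mul_one, sub_zero]
  have hct' : (1 - P) * Xᵀ = Xᵀ * (1 - P) := by rw [sub_mul, mul_sub, hct, one_mul, mul_one]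
  have hc' : (1 - P) * X = X * (1 - P) := by rw [sub_mul, mul_sub, hc, one_mul, mul_one]
  have e1 : P * (P * X + (1 - P) * Xᵀ) = P * X := by
    rw [mul_add, ← mul_assoc, ← mul_assoc, hP, hQ, zero_mul, add_zero]
  have e2 : (1 - P) * (P * X + (1 - P) * Xᵀ) = (1 - P) * Xᵀ := by
    rw [mul_add, ← mul_assoc, ← mul_assoc, hQ', hQQ, zero_mul, zero_add]
  have e3 : (P * X + (1 - P) * Xᵀ) * P = P * X := by
    rw [hct', hc, add_mul, mul_assoc, mul_assoc, hP, hQ', mul_zero, add_zero]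
  rw [rank_eq_add_of_commute_idempotent hP (e1.trans e3.symm), e1, e2,
    rank_eq_add_of_commute_idempotent hP hc]
  congr 1
  rw [← rank_transpose, transpose_mul, transpose_transpose, transpose_sub, hPt, transpose_one, hc']

theorem rank_diagonal_mul_mul_diagonal {s t : Fin n → ℂ} (hs : ∀ i, s i ≠ 0) (ht : ∀ i, t i ≠ 0)
    (M : Matrix (Fin n) (Fin n) ℂ) : (diagonal s * M * diagonal t).rank = M.rank := by
  rw [rank_mul_eq_left_of_det_ne_zero (diagonal t) _
      (by simpa [det_diagonal, Finset.prod_ne_zero_iff]),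
    rank_mul_eq_right_of_det_ne_zero (A := diagonal s) _ (by simpa [det_diagonal, Finset.prod_ne_zero_iff])]

/-- If `e_i` lies in the column space of `Y` and `e_j` in its row space, the rank of
`Y + x • E_ij` is constant except at a single value of `x`. -/
theorem rank_add_single_ne {Y : Matrix (Fin n) (Fin n) ℂ} {i j : Fin n} {w v : Fin n → ℂ}
    (hw : Y *ᵥ w = Pi.single i 1) (hv : v ᵥ* Y = Pi.single j 1) {x y : ℂ}
    (hx : 1 + x * w j = 0) (hy : y ≠ x) :
    (Y + single i j x).rank ≠ (Y + single i j y).rank := by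
  -- Both sides equal `v Y w`.
  have hvw : v i = w j := by
    have := dotProduct_mulVec v Y w
    rw [hw, hv] at this
    simpa using this
  -- As `v Y = e_j`, the perturbation is left multiplication by `1 + z e_i v`, of determinant `1 + z
  -- * w j`; only `z = x` makes it singular.
  have hfac : ∀ z : ℂ, Y + single i j z = (1 + vecMulVec (Pi.single i z) v) * Y := by
    intro z
    rw [add_mul, one_mul, vecMulVec_mul, hv]
    congr 1
    ext a b
    simp [single_apply, vecMulVec_apply, Pi.single_apply]
    grind
  have hfull : (Y + single i j y).rank = Y.rank := by
    rw [hfac]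
    apply rank_mul_eq_right_of_det_ne_zero
    rw [vecMulVec_eq Unit, det_one_add_replicateCol_mul_replicateRow]
    simp only [dotProduct_single, hvw]
    intro h
    apply hy
    have hwj : w j ≠ 0 := by
      rintro h0
      simp [h0] at hx
    apply mul_right_cancel₀ hwj
    linear_combination h - hx
  have hle : (Y + single i j x).rank < Y.rank := by
    -- At the exceptional value no kernel vector is lost, since `Y z = 0` gives `z j = v Y z = 0`,
    -- while `w` is gained.
    have hlt : LinearMap.ker Y.mulVecLin < LinearMap.ker (Y + single i j x).mulVecLin := by
      refine lt_of_le_of_ne ?_ ?_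
      · intro z hz
        have hz' : Y *ᵥ z = 0 := hz
        have : z j = 0 := by
          have := dotProduct_mulVec v Y z
          rw [hz', hv] at this
          simpa using this.symm
        simp [LinearMap.mem_ker, hz', single_mulVec, this]
      · intro h
        have hmem : w ∈ LinearMap.ker (Y + single i j x).mulVecLin := by
          rw [LinearMap.mem_ker, mulVecLin_apply, add_mulVec, hw, single_mulVec]
          ext a
          rcases eq_or_ne a i with rfl | ha
          · simpa using hx
          · simp [ha]
        rw [← h, LinearMap.mem_ker, mulVecLin_apply, hw] at hmem
        simpa using congrFun hmem i
    have h1 := Submodule.finrank_lt_finrank_of_lt hlt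
    have h2 := LinearMap.finrank_range_add_finrank_ker Y.mulVecLin
    have h3 := LinearMap.finrank_range_add_finrank_ker (Y + single i j x).mulVecLin
    unfold Matrix.rank
    omega
  omega

end RankLemmas

/-! ### Schur multipliers and the bipartite position graph. -/

section SchurMultipliers

variable {n : ℕ}

/-- The bipartite graph on rows and columns whose edges are the positions related by `F`. -/
def positionGraph (F : Fin n → Fin n → Prop) : SimpleGraph (Fin n ⊕ Fin n) :=
  SimpleGraph.fromRel fun x y => ∃ i j, x = Sum.inl i ∧ y = Sum.inr j ∧ F i j

@[simp]
theorem positionGraph_adj_inl_inr {F : Fin n → Fin n → Prop} {i j : Fin n} :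
    (positionGraph F).Adj (Sum.inl i) (Sum.inr j) ↔ F i j := by
  simp [positionGraph, SimpleGraph.fromRel_adj]

@[simp]
theorem positionGraph_adj_inr_inl {F : Fin n → Fin n → Prop} {i j : Fin n} :
    (positionGraph F).Adj (Sum.inr j) (Sum.inl i) ↔ F i j := by
  simp [positionGraph, SimpleGraph.fromRel_adj]

@[simp]
theorem positionGraph_not_adj_inl_inl {F : Fin n → Fin n → Prop} {i j : Fin n} :
    ¬ (positionGraph F).Adj (Sum.inl i) (Sum.inl j) := by
  simp [positionGraph, SimpleGraph.fromRel_adj]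

@[simp]
theorem positionGraph_not_adj_inr_inr {F : Fin n → Fin n → Prop} {i j : Fin n} :
    ¬ (positionGraph F).Adj (Sum.inr i) (Sum.inr j) := by
  simp [positionGraph, SimpleGraph.fromRel_adj]

theorem mulVec_update_of_col_eq_zero {Y : Matrix (Fin n) (Fin n) ℂ} {k : Fin n}
    (h : ∀ a, Y a k = 0) (w : Fin n → ℂ) (x : ℂ) : Y *ᵥ Function.update w k x = Y *ᵥ w := by
  ext a
  simp only [mulVec, dotProduct]
  refine Finset.sum_congr rfl fun b _ => ?_
  rcases eq_or_ne b k with rfl | hb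
  · simp [h]
  · simp [hb]

theorem update_vecMul_of_row_eq_zero {Y : Matrix (Fin n) (Fin n) ℂ} {k : Fin n}
    (h : ∀ b, Y k b = 0) (v : Fin n → ℂ) (x : ℂ) : Function.update v k x ᵥ* Y = v ᵥ* Y := by
  rw [← mulVec_transpose, ← mulVec_transpose, mulVec_update_of_col_eq_zero (Y := Yᵀ) h]

theorem vecMul_single_eq (v : Fin n → ℂ) (i k : Fin n) (x : ℂ) :
    v ᵥ* single i k x = Pi.single k (v i * x) := by
  rw [← mulVec_transpose, transpose_single, single_mulVec, mul_comm]
  rfl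

/-- A path in the position graph ending in column `j` carries a matrix having `e_j` in its row
space, up to a correction at the start of the path when that is a column. -/
theorem exists_matrix_of_isPath {F : Fin n → Fin n → Prop} {x y : Fin n ⊕ Fin n}
    (p : (positionGraph F).Walk x y) (hp : p.IsPath) (j : Fin n) (hy : y = Sum.inr j) :
    (∀ i, x = Sum.inl i → ∃ (Y : Matrix (Fin n) (Fin n) ℂ) (w v : Fin n → ℂ),
      (∀ a b, Y a b ≠ 0 → F a b ∧ Sum.inl a ∈ p.support ∧ Sum.inr b ∈ p.support) ∧
      Y *ᵥ w = Pi.single i 1 ∧ v ᵥ* Y = Pi.single j 1 ∧ w j ≠ 0) ∧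
    (∀ k, x = Sum.inr k → ∃ (Y : Matrix (Fin n) (Fin n) ℂ) (w v : Fin n → ℂ) (g : ℂ),
      (∀ a b, Y a b ≠ 0 → F a b ∧ Sum.inl a ∈ p.support ∧ Sum.inr b ∈ p.support) ∧
      Y *ᵥ w = 0 ∧ w k = 1 ∧ v ᵥ* Y = Pi.single j 1 + Pi.single k g ∧ w j ≠ 0) := by
  induction p with
  | nil =>
    subst hy
    refine ⟨fun i h => by simp at h, fun k h => ?_⟩
    obtain rfl : j = k := by simpa using h
    -- On the trivial path the correction `g = -1` cancels `e_j` itself.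
    refine ⟨0, Pi.single j 1, 0, -1, by simp, zero_mulVec _, by simp, ?_, by simp⟩
    rw [zero_vecMul, ← Pi.single_add, add_neg_cancel, Pi.single_zero]
  | @cons x z y h p ih =>
    rw [SimpleGraph.Walk.cons_isPath_iff] at hp
    obtain ⟨hp, hx⟩ := hp
    obtain ⟨ihl, ihr⟩ := ih hp hy
    subst hy
    constructor
    · rintro i rfl
      obtain l | k := z
      · simp at h
      obtain ⟨Y, w, v, g, hY, hw, hwk, hv, hwj⟩ := ihr k rfl
      have hrow : ∀ b, Y i b = 0 := fun b => by
        by_contra hb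
        exact hx (hY i b hb).2.1
      -- Row `i` of `Y` is zero because the path is simple, so `v i` is free; the value `-g` cancels
      -- the correction in column `k`.
      refine ⟨Y + single i k 1, w, Function.update v i (-g), ?_, ?_, ?_, hwj⟩
      · intro a b hab
        by_cases h0 : Y a b = 0
        · rw [Matrix.add_apply, h0, zero_add] at hab
          obtain ⟨rfl, rfl⟩ : i = a ∧ k = b := by
            by_contra hne
            exact hab (single_apply_of_ne _ _ _ _ _ hne)
          exact ⟨by simpa using h, by simp, by simp⟩
        · obtain ⟨h1, h2, h3⟩ := hY a b h0
          exact ⟨h1, by simp [h2], by simp [h3]⟩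
      · rw [add_mulVec, hw, single_mulVec, hwk, zero_add]
        ext a
        simp [Function.update_apply, Pi.single_apply]
      · rw [vecMul_add, update_vecMul_of_row_eq_zero hrow, hv, vecMul_single_eq, add_assoc,
          ← Pi.single_add]
        simp
    · rintro k rfl
      obtain l | l := z
      swap
      · simp at h
      obtain ⟨Y, w, v, hY, hw, hv, hwj⟩ := ihl l rfl
      have hcol : ∀ a, Y a k = 0 := fun a => by
        by_contra hb
        exact hx (hY a k hb).2.2
      have hjk : j ≠ k := by
        rintro rfl
        exact hx p.end_mem_support
      -- Column `k` of `Y` is zero, so `w k` is free; with `w k = 1` the new entry `-1` cancels `Y w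
      -- = e_l`.
      refine ⟨Y + single l k (-1), Function.update w k 1, v, - v l, ?_, ?_, by simp, ?_,
        by simpa [hjk]⟩
      · intro a b hab
        by_cases h0 : Y a b = 0
        · rw [Matrix.add_apply, h0, zero_add] at hab
          obtain ⟨rfl, rfl⟩ : l = a ∧ k = b := by
            by_contra hne
            exact hab (single_apply_of_ne _ _ _ _ _ hne)
          exact ⟨by simpa using h, by simp, by simp⟩
        · obtain ⟨h1, h2, h3⟩ := hY a b h0
          exact ⟨h1, by simp [h2], by simp [h3]⟩
      · rw [add_mulVec, mulVec_update_of_col_eq_zero hcol, hw, single_mulVec]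
        ext a
        simp [Function.update_apply, Pi.single_apply]
        grind
      · rw [vecMul_add, hv, vecMul_single_eq, mul_neg_one]

/-- A Schur multiplier preserving the rank of all matrices supported in `ρ` is given there by a
rank-one matrix. -/
theorem exists_eq_mul_of_rank_schur {ρ : Fin n → Fin n → Prop} {c : Fin n → Fin n → ℂ}
    (hc : ∀ i j, ρ i j → c i j ≠ 0)
    (hrank : ∀ X : Matrix (Fin n) (Fin n) ℂ, (∀ i j, X i j ≠ 0 → ρ i j) →
      (Matrix.of fun i j => c i j * X i j).rank = X.rank) :
    ∃ s t : Fin n → ℂ, (∀ i, s i ≠ 0) ∧ (∀ i, t i ≠ 0) ∧ ∀ i j, ρ i j → c i j = s i * t j := by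
  classical
  suffices H : ∀ S : Finset (Fin n × Fin n), (∀ e ∈ S, ρ e.1 e.2) →
      ∃ s t : Fin n → ℂ, (∀ i, s i ≠ 0) ∧ (∀ i, t i ≠ 0) ∧ ∀ e ∈ S, c e.1 e.2 = s e.1 * t e.2 by
    obtain ⟨s, t, hs, ht, h⟩ := H (Finset.univ.filter fun e => ρ e.1 e.2) (by simp)
    exact ⟨s, t, hs, ht, fun i j hij => h (i, j) (by simpa using hij)⟩
  intro S
  induction S using Finset.induction_on with
  | empty => exact fun _ => ⟨1, 1, by simp, by simp, by simp⟩
  | @insert e S _ ih =>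
    intro hS
    obtain ⟨s, t, hs, ht, h⟩ := ih fun e' he' => hS e' (Finset.mem_insert_of_mem he')
    obtain ⟨i, j⟩ := e
    have hij : ρ i j := hS (i, j) (Finset.mem_insert_self _ _)
    set F : Fin n → Fin n → Prop := fun a b => (a, b) ∈ S with hF
    by_cases hreach : (positionGraph F).Reachable (Sum.inl i) (Sum.inr j)
    · refine ⟨s, t, hs, ht, ?_⟩
      have hgood : c i j = s i * t j := by
        by_contra hne
        obtain ⟨p, hp⟩ := hreach.exists_isPath
        obtain ⟨Y, w, v, hY, hw, hv, hwj⟩ := (exists_matrix_of_isPath p hp j rfl).1 i rfl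
        have hsi := hs i
        have htj := ht j
        -- `x` is the exceptional value, and `y` is chosen so that `c i j * x = s i * t j * y`. The
        -- Schur image of `Y + x E_ij` is then `Y + y E_ij` scaled by `diagonal s` and `diagonal t`,
        -- so the two ranks would agree.
        refine rank_add_single_ne hw hv (x := -(w j)⁻¹)
          (y := -(w j)⁻¹ * (c i j / (s i * t j))) (by field_simp; ring) ?_ ?_
        · intro heq
          apply hne
          field_simp at heq
          linear_combination -heq
        · rw [← hrank (Y + single i j (-(w j)⁻¹)),
            ← rank_diagonal_mul_mul_diagonal hs ht (Y + single i j (-(w j)⁻¹ * (c i j / (s i * t j))))]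
          · congr 1
            ext a b
            simp only [of_apply, Matrix.add_apply, mul_diagonal, diagonal_mul]
            by_cases hab : i = a ∧ j = b
            · obtain ⟨rfl, rfl⟩ := hab
              by_cases h0 : Y i j = 0
              · simp only [h0, single_apply_same, zero_add]
                field_simp
              · exact absurd (h (i, j) (hY i j h0).1) hne
            · rw [single_apply_of_ne _ _ _ _ _ hab, single_apply_of_ne _ _ _ _ _ hab]
              by_cases h0 : Y a b = 0
              · simp [h0]
              · rw [h (a, b) (hY a b h0).1]
                ring
          · intro a b hab
            by_cases h0 : Y a b = 0
            · rw [Matrix.add_apply, h0, zero_add] at hab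
              obtain ⟨rfl, rfl⟩ : i = a ∧ j = b := by
                by_contra hne
                exact hab (single_apply_of_ne _ _ _ _ _ hne)
              exact hij
            · exact hS (a, b) (Finset.mem_insert_of_mem (hY a b h0).1)
      intro e he
      rcases Finset.mem_insert.mp he with rfl | he
      · exact hgood
      · exact h e he
    · set q : ℂ := c i j / (s i * t j) with hq
      have hsi := hs i
      have htj := ht j
      have hq0 : q ≠ 0 := div_ne_zero (hc i j hij) (mul_ne_zero hsi htj)
      -- Rescaling the component of row `i` by `q` on rows and `1/q` on columns leaves `s a * t b`
      -- unchanged on old edges, whose ends lie in one component. Column `j` lies outside, so the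
      -- new edge acquires the factor `q`.
      refine ⟨fun a => if (positionGraph F).Reachable (Sum.inl i) (Sum.inl a) then s a * q else s a,
        fun b => if (positionGraph F).Reachable (Sum.inl i) (Sum.inr b) then t b / q else t b,
        ?_, ?_, ?_⟩
      · intro a
        dsimp only
        split_ifs
        exacts [mul_ne_zero (hs a) hq0, hs a]
      · intro b
        dsimp only
        split_ifs
        exacts [div_ne_zero (ht b) hq0, ht b]
      · intro e he
        rcases Finset.mem_insert.mp he with rfl | he
        · simp only [hreach, if_false, SimpleGraph.Reachable.rfl, if_true, hq]
          field_simp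
        · have hadj : (positionGraph F).Adj (Sum.inl e.1) (Sum.inr e.2) := by simpa [hF] using he
          have hiff : (positionGraph F).Reachable (Sum.inl i) (Sum.inl e.1) ↔
              (positionGraph F).Reachable (Sum.inl i) (Sum.inr e.2) :=
            ⟨fun h => h.trans hadj.reachable, fun h => h.trans hadj.symm.reachable⟩
          by_cases hr : (positionGraph F).Reachable (Sum.inl i) (Sum.inr e.2)
          · simp only [hiff, hr, if_true, h e he]
            field_simp
          · simp only [hiff, hr, if_false, h e he]

end SchurMultipliers

/-! ### Rank preservers fixing the diagonal matrix units. -/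

section NormalizedRankPreservers

variable {n : ℕ} {ρ : Fin n → Fin n → Prop}
  {Φ : Matrix (Fin n) (Fin n) ℂ →ₗ[ℂ] Matrix (Fin n) (Fin n) ℂ}

/-- `Φ` preserves the rank of all matrices supported in `ρ`. -/
def PreservesRankOn (ρ : Fin n → Fin n → Prop)
    (Φ : Matrix (Fin n) (Fin n) ℂ →ₗ[ℂ] Matrix (Fin n) (Fin n) ℂ) : Prop :=
  ∀ X : Matrix (Fin n) (Fin n) ℂ, (∀ i j, X i j ≠ 0 → ρ i j) → (Φ X).rank = X.rank

/-- `Φ` sends the matrix unit at `(i, j)` to a matrix with nonzero entry at `(j, i)`. -/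
def IsTwisted (Φ : Matrix (Fin n) (Fin n) ℂ →ₗ[ℂ] Matrix (Fin n) (Fin n) ℂ) (i j : Fin n) : Prop :=
  Φ (single i j 1) j i ≠ 0

theorem PreservesRankOn.minor (hΦ : PreservesRankOn ρ Φ) (u v : Fin n → ℂ)
    (h : ∀ i j, u i ≠ 0 → v j ≠ 0 → ρ i j) (a b c d : Fin n) :
    Φ (vecMulVec u v) a b * Φ (vecMulVec u v) c d =
      Φ (vecMulVec u v) a d * Φ (vecMulVec u v) c b := by
  apply rank_le_one_minor
  rw [hΦ (vecMulVec u v) fun i j hij =>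
    h i j (left_ne_zero_of_mul hij) (right_ne_zero_of_mul hij)]
  exact rank_vecMulVec_le u v

theorem PreservesRankOn.minor_single (hΦ : PreservesRankOn ρ Φ) {i j : Fin n} (hij : ρ i j)
    (a b c d : Fin n) :
    Φ (single i j 1) a b * Φ (single i j 1) c d =
      Φ (single i j 1) a d * Φ (single i j 1) c b := by
  rw [single_eq_single_vecMulVec_single]
  apply hΦ.minor
  intro k l hk hl
  obtain rfl : k = i := by by_contra h; simp [h] at hk
  obtain rfl : l = j := by by_contra h; simp [h] at hl
  exact hij

theorem PreservesRankOn.minor_row (hΦ : PreservesRankOn ρ Φ) {i j k : Fin n} (hij : ρ i j)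
    (hik : ρ i k) (a b c d : Fin n) :
    (Φ (single i j 1) + Φ (single i k 1)) a b * (Φ (single i j 1) + Φ (single i k 1)) c d =
      (Φ (single i j 1) + Φ (single i k 1)) a d * (Φ (single i j 1) + Φ (single i k 1)) c b := by
  rw [← map_add, single_eq_single_vecMulVec_single, single_eq_single_vecMulVec_single,
    ← vecMulVec_add]
  apply hΦ.minor
  intro l m hl hm
  obtain rfl : l = i := by by_contra h; simp [h] at hl
  obtain rfl | rfl : m = j ∨ m = k := by
    by_contra! h
    simp [h.1, h.2] at hm
  exacts [hij, hik]

theorem PreservesRankOn.minor_col (hΦ : PreservesRankOn ρ Φ) {i j k : Fin n} (hik : ρ i k)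
    (hjk : ρ j k) (a b c d : Fin n) :
    (Φ (single i k 1) + Φ (single j k 1)) a b * (Φ (single i k 1) + Φ (single j k 1)) c d =
      (Φ (single i k 1) + Φ (single j k 1)) a d * (Φ (single i k 1) + Φ (single j k 1)) c b := by
  rw [← map_add, single_eq_single_vecMulVec_single, single_eq_single_vecMulVec_single,
    ← add_vecMulVec]
  apply hΦ.minor
  intro l m hl hm
  obtain rfl : m = k := by by_contra h; simp [h] at hm
  obtain rfl | rfl : l = i ∨ l = j := by
    by_contra! h
    simp [h.1, h.2] at hl
  exacts [hik, hjk]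

variable (hrefl : ∀ i, ρ i i) (htrans : ∀ i j k, ρ i j → ρ j k → ρ i k)
  (hΦ : PreservesRankOn ρ Φ) (hdiag : ∀ i, Φ (single i i 1) = single i i 1)

include hrefl hΦ hdiag in
-- Comparing the same 2×2 minor for `E_ii + Φ(E_ij)` and for `Φ(E_ij)` isolates the entry `(a, b)`
-- when `a, b ≠ i`. The same with `E_jj` leaves only the two listed positions.
theorem map_single_apply_eq_zero {i j : Fin n} (hij : ρ i j) (hne : i ≠ j) {a b : Fin n}
    (h : ¬ ((a = i ∧ b = j) ∨ (a = j ∧ b = i))) : Φ (single i j 1) a b = 0 := by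
  have hi : ∀ a b, a ≠ i → b ≠ i → Φ (single i j 1) a b = 0 := by
    intro a b ha hb
    have h1 := hΦ.minor_row (hrefl i) hij i i a b
    have h2 := hΦ.minor_single hij i i a b
    simp only [hdiag, Matrix.add_apply, single_apply_same, single_apply_of_ne i i (1 : ℂ) a b (by tauto),
      single_apply_of_ne i i (1 : ℂ) i b (by tauto), single_apply_of_ne i i (1 : ℂ) a i (by tauto)] at h1
    linear_combination h1 - h2
  have hj : ∀ a b, a ≠ j → b ≠ j → Φ (single i j 1) a b = 0 := by
    intro a b ha hb
    have h1 := hΦ.minor_col hij (hrefl j) j j a b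
    have h2 := hΦ.minor_single hij j j a b
    simp only [hdiag, Matrix.add_apply, single_apply_same, single_apply_of_ne j j (1 : ℂ) a b (by tauto),
      single_apply_of_ne j j (1 : ℂ) j b (by tauto), single_apply_of_ne j j (1 : ℂ) a j (by tauto)] at h1
    linear_combination h1 - h2
  by_cases h1 : a = i
  · subst h1
    exact hj _ _ hne (by tauto)
  · by_cases h2 : b = i
    · subst h2
      exact hj _ _ (by tauto) hne
    · exact hi _ _ h1 h2

include hrefl hΦ hdiag in
-- The minor on rows and columns `i, j` has zero diagonal, so one of the two off-diagonal entries
-- vanishes; both cannot, as the rank is one.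
theorem map_single_apply_ne_zero_iff {i j : Fin n} (hij : ρ i j) (hne : i ≠ j) :
    Φ (single i j 1) i j ≠ 0 ↔ ¬ IsTwisted Φ i j := by
  unfold IsTwisted
  rw [not_not]
  constructor
  · intro h
    have := hΦ.minor_single hij i j j i
    rw [map_single_apply_eq_zero hrefl hΦ hdiag hij hne (a := i) (b := i) (by grind),
      zero_mul] at this
    exact (mul_eq_zero.mp this).resolve_left h
  · intro h h'
    have h0 : Φ (single i j 1) = 0 := by
      ext a b
      by_cases hab : (a = i ∧ b = j) ∨ (a = j ∧ b = i)
      · rcases hab with ⟨rfl, rfl⟩ | ⟨rfl, rfl⟩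
        exacts [h', h]
      · exact map_single_apply_eq_zero hrefl hΦ hdiag hij hne hab
    have h1 := hΦ (single i j 1) fun a b hab => by
      obtain ⟨rfl, rfl⟩ : i = a ∧ j = b := by
        by_contra hne
        exact hab (single_apply_of_ne _ _ _ _ _ hne)
      exact hij
    rw [h0, rank_zero] at h1
    have h2 : single i j (1 : ℂ) = 0 := by
      have h3 := LinearMap.range_eq_bot.mp (Submodule.finrank_eq_zero.mp h1.symm)
      ext a b
      simpa using congrFun (LinearMap.congr_fun h3 (Pi.single b 1)) a
    simpa using congrFun (congrFun h2 i) j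

include hrefl hΦ hdiag in
-- Otherwise the rank-one matrix `E_ij + E_ik` would have an image with nonzero entries at `(j, i)`
-- and `(i, k)` but zero at `(i, i)`.
theorem IsTwisted.row {i j k : Fin n} (hij : ρ i j) (hik : ρ i k) (hj : i ≠ j) (hk : i ≠ k)
    (h : IsTwisted Φ i j) : IsTwisted Φ i k := by
  by_contra h'
  obtain rfl | hjk := eq_or_ne j k
  · exact h' h
  have h1 := (map_single_apply_ne_zero_iff hrefl hΦ hdiag hik hk).mpr h'
  have h2 := hΦ.minor_row hij hik j i i k
  have z := fun {a b} => map_single_apply_eq_zero (a := a) (b := b) hrefl hΦ hdiag hij hj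
  have z' := fun {a b} => map_single_apply_eq_zero (a := a) (b := b) hrefl hΦ hdiag hik hk
  simp only [Matrix.add_apply] at h2
  rw [z' (a := j) (b := i) (by grind), z (a := i) (b := k) (by grind),
    z (a := i) (b := i) (by grind), z' (a := i) (b := i) (by grind)] at h2
  simp only [add_zero, zero_add, mul_zero, mul_eq_zero] at h2
  exact h2.elim h h1

include hrefl hΦ hdiag in
theorem IsTwisted.col {i j k : Fin n} (hik : ρ i k) (hjk : ρ j k) (hi : i ≠ k) (hj : j ≠ k)
    (h : IsTwisted Φ i k) : IsTwisted Φ j k := by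
  by_contra h'
  obtain rfl | hij := eq_or_ne i j
  · exact h' h
  have h1 := (map_single_apply_ne_zero_iff hrefl hΦ hdiag hjk hj).mpr h'
  have h2 := hΦ.minor_col hik hjk k i j k
  have z := fun {a b} => map_single_apply_eq_zero (a := a) (b := b) hrefl hΦ hdiag hik hi
  have z' := fun {a b} => map_single_apply_eq_zero (a := a) (b := b) hrefl hΦ hdiag hjk hj
  simp only [Matrix.add_apply] at h2
  rw [z' (a := k) (b := i) (by grind), z (a := j) (b := k) (by grind),
    z (a := k) (b := k) (by grind), z' (a := k) (b := k) (by grind)] at h2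
  simp only [add_zero, zero_add, zero_mul, mul_eq_zero] at h2
  exact h2.elim h h1

include hrefl hΦ hdiag in
-- If only one of the two were twisted, the all-ones block on `i, j`, of rank one, would map to a
-- triangular block with unit diagonal.
theorem IsTwisted.symm {i j : Fin n} (hij : ρ i j) (hji : ρ j i) (hne : i ≠ j)
    (h : IsTwisted Φ i j) : IsTwisted Φ j i := by
  by_contra h'
  have h0 : Φ (single i j 1) i j = 0 := by
    by_contra h0
    exact (map_single_apply_ne_zero_iff hrefl hΦ hdiag hij hne).mp h0 h
  have h0' : Φ (single j i 1) i j = 0 := not_not.mp h'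
  have h1 := hΦ.minor (Pi.single i 1 + Pi.single j 1) (Pi.single i 1 + Pi.single j 1) (by
    intro a b ha hb
    obtain rfl | rfl : a = i ∨ a = j := by
      by_contra! h
      simp [h.1, h.2] at ha
    · obtain rfl | rfl : b = a ∨ b = j := by
        by_contra! h
        simp [h.1, h.2] at hb
      exacts [hrefl _, hij]
    · obtain rfl | rfl : b = i ∨ b = a := by
        by_contra! h
        simp [h.1, h.2] at hb
      exacts [hji, hrefl _]) i i j j
  have z := fun {a b} => map_single_apply_eq_zero (a := a) (b := b) hrefl hΦ hdiag hij hne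
  have z' := fun {a b} => map_single_apply_eq_zero (a := a) (b := b) hrefl hΦ hdiag hji hne.symm
  simp only [add_vecMulVec, vecMulVec_add, ← single_eq_single_vecMulVec_single, map_add,
    Matrix.add_apply, hdiag, h0, h0'] at h1
  rw [z (a := i) (b := i) (by grind), z' (a := i) (b := i) (by grind),
    z (a := j) (b := j) (by grind), z' (a := j) (b := j) (by grind),
    single_apply_of_ne j j (1 : ℂ) i i (by tauto), single_apply_of_ne i i (1 : ℂ) j j (by tauto),
    single_apply_of_ne i i (1 : ℂ) i j (by tauto), single_apply_of_ne j j (1 : ℂ) i j (by tauto),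
    single_apply_same, single_apply_same] at h1
  simp at h1

include hrefl htrans hΦ hdiag in
-- By transitivity `E_ik` shares a row with `E_ij` and a column with `E_jk`; the case `i = k` needs
-- the symmetric argument.
theorem IsTwisted.comp_iff {i j k : Fin n} (hij : ρ i j) (hjk : ρ j k) (hi : i ≠ j) (hk : j ≠ k) :
    IsTwisted Φ i j ↔ IsTwisted Φ j k := by
  obtain rfl | hik := eq_or_ne i k
  · exact ⟨IsTwisted.symm hrefl hΦ hdiag hij hjk hi, IsTwisted.symm hrefl hΦ hdiag hjk hij hk⟩
  · have hρ := htrans _ _ _ hij hjk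
    exact ⟨fun h => .col hrefl hΦ hdiag hρ hjk hik hk (.row hrefl hΦ hdiag hij hρ hi hik h),
      fun h => .row hrefl hΦ hdiag hρ hij hik hi (.col hrefl hΦ hdiag hjk hρ hk hik h)⟩

/-- The index `i` is the source or target of a twisted matrix unit. -/
def IsTwistedAt (ρ : Fin n → Fin n → Prop)
    (Φ : Matrix (Fin n) (Fin n) ℂ →ₗ[ℂ] Matrix (Fin n) (Fin n) ℂ) (i : Fin n) : Prop :=
  ∃ j, i ≠ j ∧ ((ρ i j ∧ IsTwisted Φ i j) ∨ (ρ j i ∧ IsTwisted Φ j i))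

include hrefl htrans hΦ hdiag in
theorem isTwistedAt_iff_left {i j : Fin n} (hij : ρ i j) (hne : i ≠ j) :
    IsTwistedAt ρ Φ i ↔ IsTwisted Φ i j := by
  constructor
  · rintro ⟨k, hik, ⟨hρ, h⟩ | ⟨hρ, h⟩⟩
    · exact .row hrefl hΦ hdiag hρ hij hik hne h
    · exact (IsTwisted.comp_iff hrefl htrans hΦ hdiag hρ hij hik.symm hne).mp h
  · exact fun h => ⟨j, hne, Or.inl ⟨hij, h⟩⟩

include hrefl htrans hΦ hdiag in
theorem isTwistedAt_iff_right {i j : Fin n} (hij : ρ i j) (hne : i ≠ j) :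
    IsTwistedAt ρ Φ j ↔ IsTwisted Φ i j := by
  constructor
  · rintro ⟨k, hik, ⟨hρ, h⟩ | ⟨hρ, h⟩⟩
    · exact (IsTwisted.comp_iff hrefl htrans hΦ hdiag hij hρ hne hik).mpr h
    · exact .col hrefl hΦ hdiag hρ hij hik.symm hne h
  · exact fun h => ⟨i, hne.symm, Or.inr ⟨hij, h⟩⟩

include hrefl htrans hΦ hdiag in
theorem isTwistedAt_iff {i j : Fin n} (hij : ρ i j) : IsTwistedAt ρ Φ i ↔ IsTwistedAt ρ Φ j := by
  obtain rfl | hne := eq_or_ne i j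
  · rfl
  · rw [isTwistedAt_iff_left hrefl htrans hΦ hdiag hij hne,
      isTwistedAt_iff_right hrefl htrans hΦ hdiag hij hne]

open Classical in
include hrefl htrans hΦ hdiag in
/-- A rank preserver fixing the diagonal matrix units is a Schur multiplier followed by a partial
transpose. -/
theorem exists_schur_of_preservesRankOn :
    ∃ c : Fin n → Fin n → ℂ, (∀ i j, ρ i j → c i j ≠ 0) ∧
      ∀ X : Matrix (Fin n) (Fin n) ℂ, (∀ i j, X i j ≠ 0 → ρ i j) → ∀ a b,
        Φ X a b = if IsTwistedAt ρ Φ a then c b a * X b a else c a b * X a b := by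
  set c : Fin n → Fin n → ℂ := fun i j =>
    if IsTwistedAt ρ Φ i then Φ (single i j 1) j i else Φ (single i j 1) i j with hc
  refine ⟨c, fun i j hij => ?_, fun X hX => ?_⟩
  · obtain rfl | hne := eq_or_ne i j
    · simp [hc, hdiag]
    · by_cases h : IsTwistedAt ρ Φ i
      · simp only [hc, h, if_true]
        exact (isTwistedAt_iff_left hrefl htrans hΦ hdiag hij hne).mp h
      · simp only [hc, h, if_false]
        rw [isTwistedAt_iff_left hrefl htrans hΦ hdiag hij hne] at h
        exact (map_single_apply_ne_zero_iff hrefl hΦ hdiag hij hne).mpr h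
  · let Ψ : Matrix (Fin n) (Fin n) ℂ →ₗ[ℂ] Matrix (Fin n) (Fin n) ℂ :=
      { toFun := fun X => Matrix.of fun a b =>
          if IsTwistedAt ρ Φ a then c b a * X b a else c a b * X a b
        map_add' := fun X Y => by
          ext a b
          simp only [of_apply, Matrix.add_apply]
          split_ifs <;> ring
        map_smul' := fun r X => by
          ext a b
          simp only [of_apply, Matrix.smul_apply, smul_eq_mul, RingHom.id_apply]
          split_ifs <;> ring }
    have hunit : ∀ i j, ρ i j → Φ (single i j 1) = Ψ (single i j 1) := by
      intro i j hij
      ext a b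
      change _ = if IsTwistedAt ρ Φ a then c b a * single i j 1 b a else c a b * single i j 1 a b
      obtain rfl | hne := eq_or_ne i j
      · rw [hdiag]
        by_cases hab : a = i ∧ b = i
        · obtain ⟨rfl, rfl⟩ := hab
          simp [hc, hdiag]
        · rw [single_apply_of_ne _ _ _ _ _ (by grind), single_apply_of_ne _ _ _ b a (by grind)]
          simp
      · have hi := isTwistedAt_iff_left hrefl htrans hΦ hdiag hij hne
        have hj := isTwistedAt_iff_right hrefl htrans hΦ hdiag hij hne
        have hα := map_single_apply_ne_zero_iff hrefl hΦ hdiag hij hne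
        by_cases h1 : a = i ∧ b = j
        · obtain ⟨rfl, rfl⟩ := h1
          rw [single_apply_same, single_apply_of_ne _ _ _ b a (by grind)]
          by_cases h : IsTwistedAt ρ Φ a
          · simp only [h, if_true, mul_zero]
            by_contra h'
            exact hα.mp h' (hi.mp h)
          · simp [hc, h]
        · by_cases h2 : a = j ∧ b = i
          · obtain ⟨rfl, rfl⟩ := h2
            rw [single_apply_same, single_apply_of_ne _ _ _ a b (by grind)]
            by_cases h : IsTwistedAt ρ Φ a
            · simp [hc, h, hi.mpr (hj.mp h)]
            · simp only [h, if_false, mul_zero]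
              exact not_not.mp (mt hj.mpr h)
          · rw [map_single_apply_eq_zero hrefl hΦ hdiag hij hne (by tauto),
              single_apply_of_ne _ _ _ a b (by grind), single_apply_of_ne _ _ _ b a (by grind)]
            simp
    have hΨ : Φ X = Ψ X := by
      rw [matrix_eq_sum_single X]
      simp only [map_sum]
      refine Finset.sum_congr rfl fun i _ => Finset.sum_congr rfl fun j _ => ?_
      by_cases h : X i j = 0
      · simp [h]
      · have : single i j (X i j) = X i j • single i j (1 : ℂ) := by simp [smul_single]
        rw [this, map_smul, map_smul, hunit i j (hX i j h)]
    intro a b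
    rw [hΨ]
    rfl

open Classical in
theorem partialTranspose_apply (q : Fin n → Prop) (X : Matrix (Fin n) (Fin n) ℂ) (a b : Fin n) :
    (diagonal (fun i => if q i then (0 : ℂ) else 1) * X +
      (1 - diagonal fun i => if q i then (0 : ℂ) else 1) * Xᵀ) a b =
      if q a then X b a else X a b := by
  rw [sub_mul, one_mul, Matrix.add_apply, Matrix.sub_apply, diagonal_mul, diagonal_mul]
  split_ifs <;> simp_all

open Classical in
theorem diagonal_indicator_commute {q : Fin n → Prop} (hq : ∀ i j, ρ i j → (q i ↔ q j))
    {X : Matrix (Fin n) (Fin n) ℂ} (hX : ∀ i j, X i j ≠ 0 → ρ i j) :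
    diagonal (fun i => if q i then (0 : ℂ) else 1) * X =
      X * diagonal fun i => if q i then (0 : ℂ) else 1 := by
  ext a b
  rw [diagonal_mul, mul_diagonal]
  by_cases h : X a b = 0
  · simp [h]
  · simp only [hq a b (hX a b h)]
    ring

open Classical in
theorem diagonal_indicator_mul_self (q : Fin n → Prop) :
    diagonal (fun i => if q i then (0 : ℂ) else 1) * diagonal (fun i => if q i then (0 : ℂ) else 1) =
      diagonal fun i => if q i then (0 : ℂ) else 1 := by
  rw [diagonal_mul_diagonal]
  congr 1
  ext i
  split_ifs <;> simp

open Classical in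
include hrefl htrans hΦ hdiag in
theorem exists_partialTranspose_of_map_single :
    ∃ (S T : Matrix (Fin n) (Fin n) ℂ) (q : Fin n → Prop), IsUnit S ∧ IsUnit T ∧
      (∀ i j, ρ i j → (q i ↔ q j)) ∧
      ∀ X : Matrix (Fin n) (Fin n) ℂ, (∀ i j, X i j ≠ 0 → ρ i j) →
        Φ X = S * (diagonal (fun i => if q i then (0 : ℂ) else 1) * X +
          (1 - diagonal fun i => if q i then (0 : ℂ) else 1) * Xᵀ) * T := by
  obtain ⟨c, hc, hX⟩ := exists_schur_of_preservesRankOn hrefl htrans hΦ hdiag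
  have hq : ∀ i j, ρ i j → (IsTwistedAt ρ Φ i ↔ IsTwistedAt ρ Φ j) :=
    fun i j => isTwistedAt_iff hrefl htrans hΦ hdiag
  generalize IsTwistedAt ρ Φ = q at hX hq
  -- The partial transpose of the Schur image of `X` is `Φ X`, so the Schur multiplier also
  -- preserves rank.
  obtain ⟨s, t, hs, ht, hst⟩ := exists_eq_mul_of_rank_schur hc (by
    intro X h
    rw [← hΦ X h, ← rank_partialTranspose (diagonal_indicator_mul_self q) (diagonal_transpose _)
      (diagonal_indicator_commute hq (X := Matrix.of fun i j => c i j * X i j)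
        fun i j hij => h i j (right_ne_zero_of_mul hij))]
    congr 1
    ext a b
    rw [hX X h, partialTranspose_apply]
    simp)
  -- At a twisted `a`, entry `(a, b)` carries `c b a = s b * t a`, so `s` and `t` exchange sides
  -- there.
  refine ⟨diagonal fun a => if q a then t a else s a, diagonal fun a => if q a then s a else t a,
    q, ?_, ?_, hq, ?_⟩
  · rw [isUnit_diagonal, Pi.isUnit_iff]
    intro i
    split_ifs
    exacts [(ht i).isUnit, (hs i).isUnit]
  · rw [isUnit_diagonal, Pi.isUnit_iff]
    intro i
    split_ifs
    exacts [(hs i).isUnit, (ht i).isUnit]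
  · intro X h
    ext a b
    rw [hX X h, mul_diagonal, diagonal_mul, partialTranspose_apply]
    by_cases ha : q a
    · simp only [ha, if_true]
      by_cases h0 : X b a = 0
      · simp [h0]
      · rw [hst _ _ (h _ _ h0), if_pos ((hq _ _ (h _ _ h0)).mpr ha)]
        ring
    · simp only [ha, if_false]
      by_cases h0 : X a b = 0
      · simp [h0]
      · rw [hst _ _ (h _ _ h0), if_neg (mt (hq _ _ (h _ _ h0)).mpr ha)]
        ring

end NormalizedRankPreservers

/-! ### Normalization of a general preserver, and central elements. -/

section RankPreservers

variable {n : ℕ} {ρ : Fin n → Fin n → Prop}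

open Classical in
-- Writing `Φ(E_ii) = u_i v_i` as an outer product, collect the `u_i` as columns of `U` and the
-- `v_i` as rows of `V`. Then `Φ(1) = U V` has rank `n`, so both are invertible and `U⁻¹ Φ(·) V⁻¹`
-- fixes every `E_ii`.
theorem exists_partialTranspose_of_preservesRankOn
    {Φ : Matrix (Fin n) (Fin n) ℂ →ₗ[ℂ] Matrix (Fin n) (Fin n) ℂ}
    (hrefl : ∀ i, ρ i i) (htrans : ∀ i j k, ρ i j → ρ j k → ρ i k) (hΦ : PreservesRankOn ρ Φ) :
    ∃ (S T : Matrix (Fin n) (Fin n) ℂ) (q : Fin n → Prop), IsUnit S ∧ IsUnit T ∧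
      (∀ i j, ρ i j → (q i ↔ q j)) ∧
      ∀ X : Matrix (Fin n) (Fin n) ℂ, (∀ i j, X i j ≠ 0 → ρ i j) →
        Φ X = S * (diagonal (fun i => if q i then (0 : ℂ) else 1) * X +
          (1 - diagonal fun i => if q i then (0 : ℂ) else 1) * Xᵀ) * T := by
  have hrank : ∀ i, ∃ u v : Fin n → ℂ, Φ (single i i 1) = vecMulVec u v := by
    intro i
    apply exists_eq_vecMulVec_of_rank_le_one
    rw [hΦ _ fun a b hab => ?_, single_eq_single_vecMulVec_single]
    · exact rank_vecMulVec_le _ _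
    · obtain ⟨rfl, rfl⟩ : i = a ∧ i = b := by
        by_contra hne
        exact hab (single_apply_of_ne _ _ _ _ _ hne)
      exact hrefl _
  choose u v huv using hrank
  set U : Matrix (Fin n) (Fin n) ℂ := Matrix.of fun a i => u i a with hU
  set V : Matrix (Fin n) (Fin n) ℂ := Matrix.of v with hV
  have hUV : ∀ i, Φ (single i i 1) = U * single i i 1 * V := by
    intro i
    rw [huv, single_eq_single_vecMulVec_single, mul_vecMulVec, vecMulVec_mul]
    congr 1
    · ext a
      simp [hU]
    · ext a
      simp [hV]
  have hone : Φ 1 = U * V := by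
    have h1 : (1 : Matrix (Fin n) (Fin n) ℂ) = ∑ i, single i i 1 := by
      rw [sum_single_one]
    rw [h1, map_sum]
    simp only [hUV]
    rw [← Finset.sum_mul, ← Finset.mul_sum, ← h1, mul_one]
  have hrank1 : (U * V).rank = n := by
    rw [← hone, hΦ 1, rank_one, Fintype.card_fin]
    intro i j hij
    obtain rfl : i = j := by
      by_contra h
      exact hij (one_apply_ne h)
    exact hrefl i
  have hunit : ∀ M : Matrix (Fin n) (Fin n) ℂ, n ≤ M.rank → IsUnit M := by
    intro M hM
    rw [← mulVec_surjective_iff_isUnit]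
    have : LinearMap.range M.mulVecLin = ⊤ := by
      apply Submodule.eq_top_of_finrank_eq
      refine le_antisymm (Submodule.finrank_le _) ?_
      rw [Module.finrank_fin_fun]
      exact hM
    exact LinearMap.range_eq_top.mp this
  have hUu : IsUnit U := hunit U (hrank1.ge.trans (rank_mul_le_left U V))
  have hVu : IsUnit V := hunit V (hrank1.ge.trans (rank_mul_le_right U V))
  have hUd : IsUnit U.det := (isUnit_iff_isUnit_det _).mp hUu
  have hVd : IsUnit V.det := (isUnit_iff_isUnit_det _).mp hVu
  obtain ⟨S, T, q, hS, hT, hq, h⟩ := exists_partialTranspose_of_map_single (ρ := ρ)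
    (Φ := LinearMap.mulRight ℂ V⁻¹ ∘ₗ LinearMap.mulLeft ℂ U⁻¹ ∘ₗ Φ) hrefl htrans (by
      intro X hX
      simp only [LinearMap.comp_apply, LinearMap.mulLeft_apply, LinearMap.mulRight_apply]
      rw [rank_mul_eq_left_of_isUnit_det _ _ (isUnit_nonsing_inv_det _ hVd),
        rank_mul_eq_right_of_isUnit_det _ _ (isUnit_nonsing_inv_det _ hUd), hΦ X hX]) (by
      intro i
      simp only [LinearMap.comp_apply, LinearMap.mulLeft_apply, LinearMap.mulRight_apply, hUV]
      rw [mul_assoc U, nonsing_inv_mul_cancel_left _ _ hUd, mul_nonsing_inv_cancel_right _ _ hVd])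
  refine ⟨U * S, T * V, q, hUu.mul hS, hT.mul hVu, hq, fun X hX => ?_⟩
  have hX' := congrArg (fun M => U * M * V) (h X hX)
  simp only [LinearMap.comp_apply, LinearMap.mulLeft_apply, LinearMap.mulRight_apply] at hX'
  rw [← mul_assoc U, mul_nonsing_inv_cancel_left _ _ hUd, nonsing_inv_mul_cancel_right _ _ hVd]
    at hX'
  rw [hX']
  simp only [mul_assoc]

open Classical in
/-- The projection of the full matrix algebra onto the matrices supported in `ρ`. -/
noncomputable def structuralProjection (ρ : Fin n → Fin n → Prop) (hrefl : ∀ i, ρ i i)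
    (htrans : ∀ i j k, ρ i j → ρ j k → ρ i k) :
    Matrix (Fin n) (Fin n) ℂ →ₗ[ℂ] structuralMatrixAlgebra ρ hrefl htrans where
  toFun X := ⟨Matrix.of fun i j => if ρ i j then X i j else 0, fun i j h => by
    by_contra hij
    exact h (by simp [hij])⟩
  map_add' X Y := by
    apply Subtype.ext
    ext i j
    by_cases h : ρ i j <;> simp [h]
  map_smul' r X := by
    apply Subtype.ext
    ext i j
    by_cases h : ρ i j <;> simp [h]

theorem structuralProjection_of_mem (hrefl : ∀ i, ρ i i)
    (htrans : ∀ i j k, ρ i j → ρ j k → ρ i k) {X : Matrix (Fin n) (Fin n) ℂ}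
    (hX : ∀ i j, X i j ≠ 0 → ρ i j) : structuralProjection ρ hrefl htrans X = ⟨X, hX⟩ := by
  apply Subtype.ext
  ext i j
  by_cases h : ρ i j
  · simp [structuralProjection, h]
  · have h0 : X i j = 0 := by
      by_contra h'
      exact h (hX i j h')
    simp [structuralProjection, h, h0]

/-- A central element of a structural matrix algebra is a diagonal matrix. -/
theorem transpose_eq_of_mem_center {hrefl : ∀ i, ρ i i}
    {htrans : ∀ i j k, ρ i j → ρ j k → ρ i k} {P : structuralMatrixAlgebra ρ hrefl htrans}
    (hP : P ∈ Subalgebra.center ℂ (structuralMatrixAlgebra ρ hrefl htrans)) :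
    (P : Matrix (Fin n) (Fin n) ℂ)ᵀ = P := by
  have hoff : ∀ i j, i ≠ j → (P : Matrix (Fin n) (Fin n) ℂ) i j = 0 := by
    intro i j hij
    have hmem : ∀ a b, (single j j (1 : ℂ)) a b ≠ 0 → ρ a b := by
      intro a b hab
      obtain ⟨rfl, rfl⟩ : j = a ∧ j = b := by
        by_contra hne
        exact hab (single_apply_of_ne _ _ _ _ _ hne)
      exact hrefl _
    -- Commuting with `E_jj` kills the off-diagonal entries of column `j`.
    have h := congrArg Subtype.val (Subalgebra.mem_center_iff.mp hP ⟨single j j 1, hmem⟩)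
    have h' := congrFun (congrFun h i) j
    simpa [hij] using h'.symm
  ext i j
  obtain rfl | hij := eq_or_ne i j
  · rfl
  · rw [transpose_apply, hoff i j hij, hoff j i hij.symm]

end RankPreservers

theorem mainTheorem2 (n : ℕ) (ρ : Fin n → Fin n → Prop)
    (hrefl : ∀ i, ρ i i) (htrans : ∀ i j k, ρ i j → ρ j k → ρ i k)
    (φ : structuralMatrixAlgebra ρ hrefl htrans → Matrix (Fin n) (Fin n) ℂ) :
    IsLinearRankPreserver φ ↔
      ∃ S T : Matrix (Fin n) (Fin n) ℂ, IsUnit S ∧ IsUnit T ∧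
        ∃ P : structuralMatrixAlgebra ρ hrefl htrans,
          P ∈ Subalgebra.center ℂ (structuralMatrixAlgebra ρ hrefl htrans) ∧
          IsIdempotentElem P ∧
          ∀ X : structuralMatrixAlgebra ρ hrefl htrans,
            φ X = S * ((P : Matrix (Fin n) (Fin n) ℂ) * (X : Matrix (Fin n) (Fin n) ℂ)
              + (1 - (P : Matrix (Fin n) (Fin n) ℂ))
                * (X : Matrix (Fin n) (Fin n) ℂ).transpose) * T := by
  classical
  constructor
  · rintro ⟨hlin, hrank⟩
    -- Precomposing with the projection extends `φ` linearly to all matrices without changing it on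
    -- the algebra.
    obtain ⟨S, T, q, hS, hT, hq, h⟩ := exists_partialTranspose_of_preservesRankOn
      (Φ := hlin.mk' φ ∘ₗ structuralProjection ρ hrefl htrans) hrefl htrans (by
        intro X hX
        rw [LinearMap.comp_apply, structuralProjection_of_mem hrefl htrans hX,
          IsLinearMap.mk'_apply, hrank])
    refine ⟨S, T, hS, hT, ⟨diagonal fun i => if q i then (0 : ℂ) else 1, fun i j hij => ?_⟩,
      ?_, ?_, ?_⟩
    · obtain rfl : i = j := by
        by_contra h
        exact hij (diagonal_apply_ne _ h)
      exact hrefl i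
    · rw [Subalgebra.mem_center_iff]
      intro X
      exact Subtype.ext (diagonal_indicator_commute hq X.2).symm
    · exact Subtype.ext (diagonal_indicator_mul_self q)
    · intro X
      rw [← h X X.2, LinearMap.comp_apply, structuralProjection_of_mem hrefl htrans X.2,
        IsLinearMap.mk'_apply]
  · rintro ⟨S, T, hS, hT, P, hP, hPP, h⟩
    refine ⟨⟨fun X Y => ?_, fun r X => ?_⟩, fun X => ?_⟩
    · simp only [h, Subalgebra.coe_add, transpose_add]
      noncomm_ring
    · simp only [h, Subalgebra.coe_smul, transpose_smul, mul_smul_comm, smul_mul_assoc, ← smul_add]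
    · rw [h, rank_mul_eq_left_of_isUnit_det _ _ ((isUnit_iff_isUnit_det _).mp hT),
        rank_mul_eq_right_of_isUnit_det _ _ ((isUnit_iff_isUnit_det _).mp hS),
        rank_partialTranspose (congrArg Subtype.val hPP) (transpose_eq_of_mem_center hP)
          (congrArg Subtype.val (Subalgebra.mem_center_iff.mp hP X)).symm]
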